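/- All sequences are real and indexed by $\mathbb{N}=\{0,1,2,\dots\}$; $\omega$ is the set of all of them. Let $f_0=f_1=1$, $f_n=f_{n-1}+f_{n-2}$ $(n\ge 2)$ be the Fibonacci numbers, and let $p=(p_k)$ be a bounded sequence of strictly positive reals. For $p_k>1$ let $p_k'=p_k/(p_k-1)$, so that $1/p_k+1/p_k'=1$. Put $$\ell(\widehat F,p)=\Big\{x\in\omega:\ \sum_{n}\Big|\frac{f_n}{f_{n+1}}x_n-\frac{f_{n+1}}{f_n}x_{n-1}\Big|^{p_n}<\infty\Big\},\qquad x_{-1}:=0 .$$ For $X\subseteq\omega$, the duals $X^\alpha$, $X^\beta$, $X^\gamma$ are the sets of all $a\in\omega$ such that, for every $x\in X$, the series $\sum_k a_kx_k$ converges absolutely, converges, has bounded partial sums, respectively. Let $\mathcal F$ be the collection of finite subsets of $\mathbb{N}$, and define (empty sums are $0$, and $B$ runs over integers) $$\widehat F_{12}(p)=\Big\{a\in\omega:\ \sup_{K\in\mathcal F}\ \sup_{k\in\mathbb N}\Big|\sum_{n\in K,\ n\ge k}\frac{f_{n+1}^2}{f_kf_{k+1}}a_n\Big|^{p_k}<\infty\Big\},$$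 $$\widehat F_{13}(p)=\bigcup_{B>1}\Big\{a\in\omega:\ \sup_{K\in\mathcal F}\ \sum_{k}\Big|\sum_{n\in K,\ n\ge k}\frac{f_{n+1}^2}{f_kf_{k+1}}a_nB^{-1}\Big|^{p_k'}<\infty\Big\}\quad(\text{when all }p_k>1),$$ $$\widehat F_{14}(p)=\bigcup_{B>1}\Big\{a\in\omega:\ \sup_{n\in\mathbb N}\ \sum_{0\le k\le n,\ p_k>1}\Big|\sum_{j=k}^{n}\frac{f_{j+1}^2}{f_kf_{k+1}}a_jB^{-1}\Big|^{p_k'}<\infty\Big\},$$ $$\widehat F_{15}(p)=\Big\{a\in\omega:\ \sup_{n,k\in\mathbb N}\Big|\sum_{j=k}^{n}\frac{f_{j+1}^2}{f_kf_{k+1}}a_j\Big|^{p_k}<\infty\Big\},$$ $$\widehat F_{16}(p)=\Big\{a\in\omega:\ \lim_{n\to\infty}\sum_{j=k}^{n}\frac{f_{j+1}^2}{f_kf_{k+1}}a_j\ \text{ exists in }\mathbb{R}\text{ for every }k\in\mathbb N\Big\}.$$ Then: (i) $\{\ell(\widehat F,p)\}^{\alpha}=\widehat F_{12}(p)$ if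 $0<p_k\le 1$ for all $k$, and $\{\ell(\widehat F,p)\}^{\alpha}=\widehat F_{13}(p)$ if $p_k>1$ for all $k$. (ii) $\{\ell(\widehat F,p)\}^{\gamma}=\widehat F_{15}(p)$ if $0<p_k\le 1$ for all $k$, and $\{\ell(\widehat F,p)\}^{\gamma}=\widehat F_{14}(p)$ if $p_k>1$ for all $k$. (iii) For every bounded sequence $p$ of strictly positive reals, $\{\ell(\widehat F,p)\}^{\beta}=\widehat F_{14}(p)\cap\widehat F_{15}(p)\cap\widehat F_{16}(p)$. -/

import Mathlib

open Filter Topology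

noncomputable section

namespace FibSeq

/-- The Fibonacci numbers with `f 0 = f 1 = 1`, as real numbers. -/
def f (n : ℕ) : ℝ := (Nat.fib (n + 1) : ℝ)

/-- The matrix `F̂` with `-f (n+1) / f n` in place `(n, n-1)` and `f n / f (n+1)` in place `(n, n)`. -/
def fibMatrix (n k : ℕ) : ℝ :=
  if k + 1 = n then -(f (n + 1) / f n) else if k = n then f n / f (n + 1) else 0

/-- The `F̂`-transform of `x`; row `n` of `F̂` vanishes beyond column `n`, so the sum is finite. -/
def fibTransform (x : ℕ → ℝ) (n : ℕ) : ℝ := ∑ k ∈ Finset.range (n + 1), fibMatrix n k * x k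

/-- In coordinates (with the convention `x (-1) = 0`), row `0`. -/
theorem fibTransform_zero (x : ℕ → ℝ) : fibTransform x 0 = f 0 / f 1 * x 0 := by
  simp [fibTransform, fibMatrix]

/-- In coordinates, row `n + 1`. -/
theorem fibTransform_succ (x : ℕ → ℝ) (n : ℕ) :
    fibTransform x (n + 1) =
      f (n + 1) / f (n + 2) * x (n + 1) - f (n + 2) / f (n + 1) * x n := by
  have h : ∑ k ∈ Finset.range n, fibMatrix (n + 1) k * x k = 0 := by
    refine Finset.sum_eq_zero fun k hk => ?_
    have hk' := Finset.mem_range.mp hk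
    have h1 : k ≠ n := by omega
    have h2 : k ≠ n + 1 := by omega
    simp [fibMatrix, h1, h2]
  rw [fibTransform, Finset.sum_range_succ, Finset.sum_range_succ, h]
  simp [fibMatrix]
  ring

/-- Maddox's space `ℓ(p)` of real sequences. -/
def ell (p : ℕ → ℝ) : Set (ℕ → ℝ) := {x | Summable fun k => |x k| ^ p k}

/-- The space `ℓ(F̂, p)` of all sequences whose `F̂`-transform is in `ℓ(p)`. -/
def ellF (p : ℕ → ℝ) : Set (ℕ → ℝ) := {x | fibTransform x ∈ ell p}

/-- Absolutely convergent series. -/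
def ell1 : Set (ℕ → ℝ) := {x | Summable fun k => |x k|}

/-- Convergent series. -/
def cs : Set (ℕ → ℝ) :=
  {x | ∃ l : ℝ, Tendsto (fun n => ∑ k ∈ Finset.range (n + 1), x k) atTop (𝓝 l)}

/-- Bounded series. -/
def bs : Set (ℕ → ℝ) :=
  {x | BddAbove (Set.range fun n : ℕ => |∑ k ∈ Finset.range (n + 1), x k|)}

/-- `S(X, Y)`, the sequences that multiply `X` into `Y`. -/
def mult (X Y : Set (ℕ → ℝ)) : Set (ℕ → ℝ) := {z | ∀ x ∈ X, (fun k => x k * z k) ∈ Y}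

def alphaDual (X : Set (ℕ → ℝ)) : Set (ℕ → ℝ) := mult X ell1

def betaDual (X : Set (ℕ → ℝ)) : Set (ℕ → ℝ) := mult X cs

def gammaDual (X : Set (ℕ → ℝ)) : Set (ℕ → ℝ) := mult X bs

/-- The conjugate exponent `q'`, with `1/q + 1/q' = 1`; used for `1 < q` only. -/
def conj (q : ℝ) : ℝ := q / (q - 1)

/-- `sup` over finite `K` and all `k` of `|∑_{n ∈ K, n ≥ k} f_{n+1}² a_n / (f_k f_{k+1})| ^ p_k`
is finite. -/
def F12 (p : ℕ → ℝ) : Set (ℕ → ℝ) :=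
  {a | BddAbove (Set.range fun q : Finset ℕ × ℕ =>
    |∑ n ∈ q.1 with q.2 ≤ n, f (n + 1) ^ 2 / (f q.2 * f (q.2 + 1)) * a n| ^ p q.2)}

/-- For some integer `B > 1`, the `sup` over finite `K` of
`∑_k |∑_{n ∈ K, n ≥ k} f_{n+1}² a_n B⁻¹ / (f_k f_{k+1})| ^ p_k'` is finite. -/
def F13 (p : ℕ → ℝ) : Set (ℕ → ℝ) :=
  {a | ∃ B : ℕ, 1 < B ∧
    (⨆ K : Finset ℕ, ∑' k : ℕ, ENNReal.ofReal
      (|∑ n ∈ K with k ≤ n, f (n + 1) ^ 2 / (f k * f (k + 1)) * a n * (B : ℝ)⁻¹|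
        ^ conj (p k))) < ⊤}

/-- For some integer `B > 1`, the `sup` over `n` of
`∑_{k ≤ n} |∑_{j=k}^n f_{j+1}² a_j B⁻¹ / (f_k f_{k+1})| ^ p_k'` is finite. The summation is over
the `k` for which the exponent `p_k'` makes sense, i.e. `p_k > 1`. -/
def F14 (p : ℕ → ℝ) : Set (ℕ → ℝ) :=
  {a | ∃ B : ℕ, 1 < B ∧
    BddAbove (Set.range fun n : ℕ => ∑ k ∈ Finset.range (n + 1) with 1 < p k,
      |∑ j ∈ Finset.Icc k n, f (j + 1) ^ 2 / (f k * f (k + 1)) * a j * (B : ℝ)⁻¹|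
        ^ conj (p k))}

/-- `sup` over `n, k` of `|∑_{j=k}^n f_{j+1}² a_j / (f_k f_{k+1})| ^ p_k` is finite. -/
def F15 (p : ℕ → ℝ) : Set (ℕ → ℝ) :=
  {a | BddAbove (Set.range fun q : ℕ × ℕ =>
    |∑ j ∈ Finset.Icc q.2 q.1, f (j + 1) ^ 2 / (f q.2 * f (q.2 + 1)) * a j| ^ p q.2)}

/-- For each `k`, the limit of `∑_{j=k}^n f_{j+1}² a_j / (f_k f_{k+1})` as `n → ∞` exists. -/
def F16 : Set (ℕ → ℝ) :=
  {a | ∀ k : ℕ, ∃ l : ℝ, Tendsto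
    (fun n : ℕ => ∑ j ∈ Finset.Icc k n, f (j + 1) ^ 2 / (f k * f (k + 1)) * a j) atTop (𝓝 l)}

end FibSeq

end

/-! `fibTransform` is a bijection of sequences with inverse `fibInverse`, so `x` in `ℓ(F̂, p)` may
be written `fibInverse y` with `y` in `ℓ(p)`. Interchanging finite sums, `∑ n ∈ K, a n * x n`
becomes `∑ k, coef a K k * y k` (`sum_fibInverse_mul`). Membership in the α-dual is then pointwise
boundedness on `ℓ(p)` of the functionals indexed by all finite `K`; the γ-dual uses only initial
segments.

Such a family is pointwise bounded iff `|c i k| ^ p k` is bounded over `p k ≤ 1` and, for some `B`,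
the sums of `|c i k / B| ^ p k'` over `p k > 1` are bounded (`pointwise_bounded_iff`). Necessity is
a Baire argument followed by testing on Hölder extremals; sufficiency is Young's inequality, which
makes tails uniformly small (`exists_uniform_tail`).

For the β-dual, convergence implies boundedness, and unit vectors give the limits of the
coefficients. Conversely, uniform tails and convergent coefficients make the partial sums Cauchy. -/

namespace FibSeq

/-! ### Signed powers. -/

/-- The signed power `sign t * |t| ^ a`, written so that continuity is evident. -/
noncomputable def spow (a t : ℝ) : ℝ := (max t 0) ^ a - (max (-t) 0) ^ a

theorem continuous_spow {a : ℝ} (ha : 0 ≤ a) : Continuous (spow a) := by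
  unfold spow
  exact ((Real.continuous_rpow_const ha).comp (by fun_prop)).sub
    ((Real.continuous_rpow_const ha).comp (by fun_prop))

theorem spow_of_nonneg {a t : ℝ} (ha : a ≠ 0) (ht : 0 ≤ t) : spow a t = t ^ a := by
  simp [spow, ht, Real.zero_rpow ha]

theorem spow_neg (a t : ℝ) : spow a (-t) = -spow a t := by
  simp [spow]

theorem abs_spow {a : ℝ} (ha : a ≠ 0) (t : ℝ) : |spow a t| = |t| ^ a := by
  rcases le_total 0 t with ht | ht
  · rw [spow_of_nonneg ha ht, abs_of_nonneg ht, abs_of_nonneg (Real.rpow_nonneg ht a)]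
  · have h : 0 ≤ -t := by linarith
    rw [← neg_neg t, spow_neg, spow_of_nonneg ha h, abs_neg, abs_neg, abs_of_nonneg h,
      abs_of_nonneg (Real.rpow_nonneg h a)]

theorem spow_inv_spow {a : ℝ} (ha : a ≠ 0) (t : ℝ) : spow a⁻¹ (spow a t) = t := by
  rcases le_total 0 t with ht | ht
  · rw [spow_of_nonneg ha ht, spow_of_nonneg (inv_ne_zero ha) (Real.rpow_nonneg ht a),
      Real.rpow_rpow_inv ht ha]
  · have h : 0 ≤ -t := by linarith
    rw [← neg_neg t, spow_neg, spow_neg, spow_of_nonneg ha h,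
      spow_of_nonneg (inv_ne_zero ha) (Real.rpow_nonneg h a), Real.rpow_rpow_inv h ha]

theorem spow_zero {a : ℝ} : spow a 0 = 0 := by simp [spow]

section Functionals

variable {ι : Type*} {p : ℕ → ℝ} {c : ι → ℕ → ℝ} {S : ι → Finset ℕ}

/-! ### Necessity of the bounds: Baire category and Hölder extremals. -/

/-- Uniform boundedness on `ℓ(p)`: finitely supported functionals that are pointwise bounded are
bounded on a modular ball of sequences vanishing on some finite set. -/
theorem exists_uniform_bound (hpos : ∀ k, 0 < p k)
    (hS : ∀ i k, k ∉ S i → c i k = 0)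
    (hb : ∀ y ∈ ell p, ∃ M, ∀ i, |∑ k ∈ S i, c i k * y k| ≤ M) :
    ∃ s : Finset ℕ, ∃ r > 0, ∃ M, ∀ t : Finset ℕ, Disjoint s t → ∀ z : ℕ → ℝ,
      ∑ k ∈ t, |z k| ^ p k < r → ∀ i, |∑ k ∈ t, c i k * z k| ≤ M := by
  classical
  -- Signed roots carry `ℓ¹` into `ℓ(p)` and turn `∑ |y k| ^ p k` into the `ℓ¹` norm, so Baire
  -- applies in a Banach space even if some `p k < 1`.
  let Y : lp (fun _ : ℕ => ℝ) 1 → ℕ → ℝ := fun u k => spow (p k)⁻¹ (u k)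
  let E : ℕ → Set (lp (fun _ : ℕ => ℝ) 1) :=
    fun M => {u | ∀ i, |∑ k ∈ S i, c i k * Y u k| ≤ M}
  have hcoord : ∀ k, Continuous fun u : lp (fun _ : ℕ => ℝ) 1 => u k := fun k =>
    (continuous_apply k).comp (lp.uniformContinuous_coe).continuous
  have hY : ∀ k, Continuous fun u => Y u k := fun k =>
    (continuous_spow (inv_nonneg.2 (hpos k).le)).comp (hcoord k)
  have hclosed : ∀ M, IsClosed (E M) := by
    intro M
    simp only [E, Set.ofPred_forall]
    refine isClosed_iInter fun i => isClosed_le ?_ continuous_const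
    exact (continuous_finsetSum _ fun k _ => continuous_const.mul (hY k)).abs
  have hunion : ⋃ M, E M = Set.univ := by
    refine Set.eq_univ_of_forall fun u => ?_
    have hmem : Y u ∈ ell p := by
      have h1 := (lp.memℓp u).summable (by norm_num)
      simp only [ENNReal.toReal_one, Real.rpow_one, Real.norm_eq_abs] at h1
      refine h1.congr fun k => ?_
      rw [abs_spow (inv_ne_zero (hpos k).ne'), Real.rpow_inv_rpow (abs_nonneg _) (hpos k).ne']
    obtain ⟨M, hM⟩ := hb _ hmem
    obtain ⟨n, hn⟩ := exists_nat_ge M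
    exact Set.mem_iUnion.2 ⟨n, fun i => (hM i).trans hn⟩
  obtain ⟨M, u₀, hu₀⟩ := nonempty_interior_of_iUnion_of_closed hclosed hunion
  obtain ⟨ε, hε, hball⟩ := Metric.isOpen_iff.1 isOpen_interior u₀ hu₀
  have hlim := lp.hasSum_single (p := 1) (by norm_num) u₀
  obtain ⟨s, hs⟩ := (Metric.tendsto_nhds.1 hlim (ε / 2) (half_pos hε)).exists
  -- `Y` is not linear, but `w` lives on `s` and the perturbation `v` off `s`. Coordinatewise one of
  -- them vanishes, so `Y (w + v) - Y w` is exactly `z` on `t`.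
  set w := ∑ k ∈ s, lp.single 1 k (u₀ k) with hw
  have hEv : ∀ v, ‖v‖ < ε / 2 → w + v ∈ E M := by
    intro v hv
    refine interior_subset (hball ?_)
    rw [Metric.mem_ball, dist_eq_norm]
    rw [dist_eq_norm] at hs
    calc ‖w + v - u₀‖ = ‖(w - u₀) + v‖ := by congr 1; abel
      _ ≤ ‖w - u₀‖ + ‖v‖ := norm_add_le _ _
      _ < ε := by linarith
  have hsum : ∀ (t : Finset ℕ) (g : ℕ → ℝ) (k : ℕ),
      (∑ j ∈ t, lp.single (E := fun _ : ℕ => ℝ) 1 j (g j)) k = if k ∈ t then g k else 0 := by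
    intro t g k
    rw [lp.coeFn_sum, Finset.sum_apply]
    simp only [lp.coeFn_single, Pi.single_apply]
    simp
  refine ⟨s, ε / 2, half_pos hε, 2 * M, fun t hst z hz i => ?_⟩
  set v := ∑ k ∈ t, lp.single (E := fun _ : ℕ => ℝ) 1 k (spow (p k) (z k)) with hv
  have hvn : ‖v‖ < ε / 2 := by
    have h1 := lp.norm_sum_single (p := 1) (E := fun _ : ℕ => ℝ) (by norm_num)
      (fun k => spow (p k) (z k)) t
    simp only [ENNReal.toReal_one, Real.rpow_one, Real.norm_eq_abs] at h1
    rw [hv, h1]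
    refine lt_of_eq_of_lt (Finset.sum_congr rfl fun k _ => ?_) hz
    rw [abs_spow (hpos k).ne']
  have h1 := hEv v hvn i
  have h2 := hEv 0 (by simpa using hε) i
  have key : ∑ k ∈ t, c i k * z k
      = ∑ k ∈ S i, c i k * Y (w + v) k - ∑ k ∈ S i, c i k * Y (w + 0) k := by
    rw [← Finset.sum_sub_distrib]
    have hterm : ∀ k, c i k * Y (w + v) k - c i k * Y (w + 0) k
        = if k ∈ t then c i k * z k else 0 := by
      intro k
      have e1 : (w + v) k = w k + v k := rfl
      have e2 : (w + 0) k = w k := by rw [add_zero]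
      simp only [Y, e1, e2]
      rw [hw, hv, hsum, hsum]
      by_cases hk : k ∈ t
      · have hk' : k ∉ s := fun h => Finset.disjoint_left.1 hst h hk
        simp [hk, hk', spow_inv_spow (hpos k).ne', spow_zero]
      · simp [hk]
    simp_rw [hterm]
    rw [← Finset.sum_filter]
    refine (Finset.sum_subset_zero_on_sdiff (fun k hk => (Finset.mem_filter.1 hk).2) ?_
      fun _ _ => rfl).symm
    intro k hk
    simp only [Finset.mem_sdiff, Finset.mem_filter, not_and] at hk
    rw [hS i k fun h => hk.2 h hk.1, zero_mul]
  rw [key]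
  rw [abs_le] at h1 h2 ⊢
  constructor <;> linarith

theorem single_mem_ell (hpos : ∀ k, 0 < p k) (k : ℕ) : (Pi.single k 1 : ℕ → ℝ) ∈ ell p := by
  refine summable_of_ne_finset_zero (s := {k}) fun j hj => ?_
  rw [Pi.single_eq_of_ne (by simpa using hj), abs_zero, Real.zero_rpow (hpos j).ne']

theorem exists_coordinate_bound (hpos : ∀ k, 0 < p k)
    (hS : ∀ i k, k ∉ S i → c i k = 0)
    (hb : ∀ y ∈ ell p, ∃ M, ∀ i, |∑ k ∈ S i, c i k * y k| ≤ M) :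
    ∃ C : ℕ → ℝ, ∀ i k, |c i k| ≤ C k := by
  have h : ∀ k, ∃ M, ∀ i, |c i k| ≤ M := by
    intro k
    obtain ⟨M, hM⟩ := hb _ (single_mem_ell hpos k)
    refine ⟨M, fun i => ?_⟩
    convert hM i using 2
    by_cases hk : k ∈ S i
    · simp [Pi.single_apply, hk]
    · simp [Pi.single_apply, hk, hS i k hk]
  choose C hC using h
  exact ⟨C, fun i k => hC k i⟩

theorem holderConjugate_conj {q : ℝ} (hq : 1 < q) : q.HolderConjugate (conj q) :=
  Real.HolderConjugate.conjExponent hq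

/-- Necessity of the two bounds. -/
theorem bounds_of_pointwise_bounded (hpos : ∀ k, 0 < p k)
    (hS : ∀ i k, k ∉ S i → c i k = 0)
    (hb : ∀ y ∈ ell p, ∃ M, ∀ i, |∑ k ∈ S i, c i k * y k| ≤ M) :
    (∃ M, ∀ i k, p k ≤ 1 → |c i k| ^ p k ≤ M) ∧
    ∃ B : ℕ, 1 < B ∧ ∃ M, ∀ i, ∀ T : Finset ℕ, (∀ k ∈ T, 1 < p k) →
      ∑ k ∈ T, |c i k * (B : ℝ)⁻¹| ^ conj (p k) ≤ M := by
  classical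
  obtain ⟨C, hC⟩ := exists_coordinate_bound hpos hS hb
  obtain ⟨s, r₀, hr₀, M₀, hM₀⟩ := exists_uniform_bound hpos hS hb
  -- Normalised so that `M ^ p k ≤ M` when `p k ≤ 1`, and powers of `r / 2 < 1` decrease in the
  -- exponent.
  obtain ⟨r, hr, hr1, M, hM1, hM⟩ : ∃ r > 0, r ≤ 1 ∧ ∃ M ≥ 1, ∀ t : Finset ℕ, Disjoint s t →
      ∀ z : ℕ → ℝ, ∑ k ∈ t, |z k| ^ p k < r → ∀ i, |∑ k ∈ t, c i k * z k| ≤ M :=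
    ⟨min r₀ 1, lt_min hr₀ one_pos, min_le_right _ _, max M₀ 1, le_max_right _ _,
      fun t ht z hz i => (hM₀ t ht z (hz.trans_le (min_le_left _ _)) i).trans (le_max_left _ _)⟩
  have hsingle : ∀ i, ∀ k ∉ s, |c i k| * (r / 2) ^ (p k)⁻¹ ≤ M := by
    intro i k hk
    have h0 : 0 ≤ (r / 2) ^ (p k)⁻¹ := by positivity
    have := hM {k} (by simpa using hk) (fun k => (r / 2) ^ (p k)⁻¹) (by
      rw [Finset.sum_singleton, abs_of_nonneg h0,
        Real.rpow_inv_rpow (by positivity) (hpos k).ne']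
      linarith) i
    rwa [Finset.sum_singleton, abs_mul, abs_of_nonneg h0] at this
  constructor
  · refine ⟨M * (2 / r) + ∑ k ∈ s, C k ^ p k, fun i k hk1 => ?_⟩
    have hC0 : ∀ k, 0 ≤ C k := fun k => (abs_nonneg _).trans (hC i k)
    have hsum0 : 0 ≤ ∑ k ∈ s, C k ^ p k :=
      Finset.sum_nonneg fun k _ => Real.rpow_nonneg (hC0 k) _
    have hMr : 0 ≤ M * (2 / r) := by positivity
    by_cases hk : k ∈ s
    · have h1 : |c i k| ^ p k ≤ C k ^ p k :=
        Real.rpow_le_rpow (abs_nonneg _) (hC i k) (hpos k).le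
      have h2 := Finset.single_le_sum (f := fun k => C k ^ p k)
        (fun k _ => Real.rpow_nonneg (hC0 k) _) hk
      linarith
    · have h1 := Real.rpow_le_rpow (by positivity) (hsingle i k hk) (hpos k).le
      rw [Real.mul_rpow (abs_nonneg _) (by positivity),
        Real.rpow_inv_rpow (by positivity) (hpos k).ne'] at h1
      have h2 : M ^ p k ≤ M := by
        simpa using Real.rpow_le_rpow_of_exponent_le hM1 hk1
      have h3 : |c i k| ^ p k ≤ M * (2 / r) := by
        rw [mul_div_assoc', le_div_iff₀ hr]
        linarith
      linarith
  -- This size of `B` makes every single term off `s`, and also `M / B`, less than `r / 2`.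
  · obtain ⟨B, hB⟩ := exists_nat_gt (4 * M / r ^ 2 + 1)
    have hq : 0 ≤ 4 * M / r ^ 2 := by positivity
    have hB1 : (1 : ℝ) < B := by linarith
    have hB0 : (0 : ℝ) < B := by linarith
    have hBr : 4 * M < B * r ^ 2 := by
      rw [← div_lt_iff₀ (by positivity)]; linarith
    have hterm : ∀ i, ∀ k ∉ s, 1 < p k → |c i k * (B : ℝ)⁻¹| ^ conj (p k) < r / 2 := by
      intro i k hk hpk
      have h1 : r / 2 ≤ (r / 2) ^ (p k)⁻¹ := by
        have := Real.rpow_le_rpow_of_exponent_ge (x := r / 2) (by positivity) (by linarith)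
          (inv_le_one_of_one_le₀ hpk.le)
        simpa using this
      have h2 : |c i k| * (r / 2) ≤ M :=
        (mul_le_mul_of_nonneg_left h1 (abs_nonneg _)).trans (hsingle i k hk)
      have h3 : |c i k * (B : ℝ)⁻¹| < r / 2 := by
        rw [abs_mul, abs_inv, abs_of_pos hB0, ← div_eq_mul_inv, div_lt_iff₀ hB0]
        by_contra hcon
        push Not at hcon
        nlinarith
      have h4 := Real.rpow_le_rpow_of_exponent_ge' (abs_nonneg (c i k * (B : ℝ)⁻¹))
        (by linarith) zero_le_one (holderConjugate_conj hpk).symm.lt.le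
      rw [Real.rpow_one] at h4
      linarith
    have hMB : M / B < r / 2 := by
      rw [div_lt_iff₀ hB0]
      nlinarith
    -- Bootstrap: a sum at most `M / B < r / 2` plus one new term stays below `r`, so the ball
    -- estimate applies and brings the enlarged sum back to at most `M / B`.
    have hoff : ∀ i, ∀ T : Finset ℕ, Disjoint s T → (∀ k ∈ T, 1 < p k) →
        ∑ k ∈ T, |c i k * (B : ℝ)⁻¹| ^ conj (p k) ≤ M / B := by
      intro i T
      induction T using Finset.induction_on with
      | empty => intro _ _; simp; positivity
      | insert a T ha ih =>
        intro hd hp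
        rw [Finset.disjoint_insert_right] at hd
        have h1 := ih hd.2 fun k hk => hp k (Finset.mem_insert_of_mem hk)
        have h2 := hterm i a hd.1 (hp a (Finset.mem_insert_self _ _))
        have h3 : ∑ k ∈ insert a T, |c i k * (B : ℝ)⁻¹| ^ conj (p k) < r := by
          rw [Finset.sum_insert ha]; linarith
        -- Equality case of Hölder: `|z k| ^ p k` and `c i k * z k / B` both equal the `k`-th term
        -- of the sum.
        let z : ℕ → ℝ := fun k => spow (conj (p k) - 1) (c i k * (B : ℝ)⁻¹)
        have hz : ∀ k ∈ insert a T, |z k| ^ p k = |c i k * (B : ℝ)⁻¹| ^ conj (p k) := by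
          intro k hk
          have hc := holderConjugate_conj (hp k hk)
          rw [abs_spow hc.symm.sub_one_ne_zero, ← Real.rpow_mul (abs_nonneg _)]
          congr 1
          have := hc.mul_eq_add
          linarith
        have hcz : ∀ k ∈ insert a T,
            c i k * z k = B * |c i k * (B : ℝ)⁻¹| ^ conj (p k) := by
          intro k hk
          have hc := holderConjugate_conj (hp k hk)
          have hne := hc.symm.sub_one_ne_zero
          have hgen : ∀ d : ℝ, d * spow (conj (p k) - 1) d = |d| ^ conj (p k) := by
            have hnn : ∀ d : ℝ, 0 ≤ d → d * spow (conj (p k) - 1) d = |d| ^ conj (p k) := by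
              intro d hd
              rw [spow_of_nonneg hne hd, abs_of_nonneg hd]
              conv_lhs => rw [mul_comm, ← Real.rpow_add_one' hd (by simpa using hc.symm.ne_zero)]
              simp
            intro d
            rcases le_total 0 d with hd | hd
            · exact hnn d hd
            · rw [← abs_neg, ← hnn (-d) (by linarith), spow_neg]; ring
          rw [← hgen]
          simp only [z]
          field_simp
        have h4 := hM (insert a T) (Finset.disjoint_insert_right.2 hd) z
          (by rwa [Finset.sum_congr rfl hz]) i
        rw [Finset.sum_congr rfl hcz, ← Finset.mul_sum] at h4
        rw [le_div_iff₀ hB0, mul_comm]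
        exact (le_abs_self _).trans h4
    refine ⟨B, by exact_mod_cast hB1,
      ∑ k ∈ s, (C k * (B : ℝ)⁻¹) ^ conj (p k) + M / B, fun i T hT => ?_⟩
    have hC0 : ∀ k, 0 ≤ C k := fun k => (abs_nonneg _).trans (hC i k)
    rw [← Finset.sum_filter_add_sum_filter_not T (· ∈ s)]
    refine add_le_add ?_ (hoff i _ ?_ fun k hk => hT k (Finset.mem_filter.1 hk).1)
    · calc ∑ k ∈ T with k ∈ s, |c i k * (B : ℝ)⁻¹| ^ conj (p k)
          ≤ ∑ k ∈ T with k ∈ s, (C k * (B : ℝ)⁻¹) ^ conj (p k) := by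
            refine Finset.sum_le_sum fun k hk => Real.rpow_le_rpow (abs_nonneg _) ?_
              (holderConjugate_conj (hT k (Finset.mem_filter.1 hk).1)).symm.nonneg
            rw [abs_mul, abs_inv, abs_of_pos hB0]
            exact mul_le_mul_of_nonneg_right (hC i k) (by positivity)
        _ ≤ _ := Finset.sum_le_sum_of_subset_of_nonneg
            (fun k hk => (Finset.mem_filter.1 hk).2)
            fun k _ _ => Real.rpow_nonneg (mul_nonneg (hC0 k) (by positivity)) _
    · rw [Finset.disjoint_left]
      intro k hk hk'
      exact (Finset.mem_filter.1 hk').2 hk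

/-! ### Sufficiency of the bounds, and convergence. -/

/-- Uniformly small tails: the two bounds control `∑ |c i k * y k|` off a finite set. -/
theorem exists_uniform_tail (hpos : ∀ k, 0 < p k) (hbdd : BddAbove (Set.range p))
    (hA : ∃ M, ∀ i k, p k ≤ 1 → |c i k| ^ p k ≤ M)
    (hB : ∃ B : ℕ, 1 < B ∧ ∃ M, ∀ i, ∀ T : Finset ℕ, (∀ k ∈ T, 1 < p k) →
      ∑ k ∈ T, |c i k * (B : ℝ)⁻¹| ^ conj (p k) ≤ M)
    {y : ℕ → ℝ} (hy : y ∈ ell p) {ε : ℝ} (hε : 0 < ε) :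
    ∃ s : Finset ℕ, ∀ T : Finset ℕ, Disjoint T s → ∀ i, ∑ k ∈ T, |c i k * y k| ≤ ε := by
  classical
  obtain ⟨H, hH⟩ := hbdd
  replace hH : ∀ k, p k ≤ H := fun k => hH ⟨k, rfl⟩
  obtain ⟨M₁, hM₁⟩ := hA
  obtain ⟨B, hB1, M₂, hM₂⟩ := hB
  have hB0 : (0 : ℝ) < B := by exact_mod_cast (zero_lt_one.trans hB1)
  set M := max M₁ 1 with hMdef
  have hM0 : 0 < M := lt_max_of_lt_right one_pos
  set N := max M₂ 1 with hNdef
  have hN0 : 0 < N := lt_max_of_lt_right one_pos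
  -- Young is applied to `(|y k| / δ) * (δ * |c i k / B|)`. As `δ ≤ 1 < p k'`, the coefficient part
  -- costs at most `B * δ * N ≤ ε / 2`; the other part gains at most `δ ^ (-H)`.
  set δ := min 1 (ε / (2 * (B * N))) with hδdef
  have hδ0 : 0 < δ := lt_min one_pos (by positivity)
  have hδ1 : δ ≤ 1 := min_le_left _ _
  have hδN : B * δ * N ≤ ε / 2 := by
    have : δ ≤ ε / (2 * (B * N)) := min_le_right _ _
    rw [le_div_iff₀ (by positivity)] at this
    linarith
  have hδH : 0 < δ ^ (-H) := Real.rpow_pos_of_pos hδ0 _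
  set K := M + B * δ ^ (-H) with hKdef
  have hK0 : 0 < K := by positivity
  -- The bound `1 / M` forces `|c i k * y k| ≤ 1` where `p k ≤ 1`, so there the product is at most
  -- its own `p k`-th power.
  set η := min (1 / M) (ε / (2 * K)) with hηdef
  have hη0 : 0 < η := lt_min (by positivity) (by positivity)
  obtain ⟨s, hs⟩ := summable_iff_vanishing_norm.1 (show Summable fun k => |y k| ^ p k from hy) η hη0
  have hnn : ∀ k, 0 ≤ |y k| ^ p k := fun k => Real.rpow_nonneg (abs_nonneg _) _
  refine ⟨s, fun T hT i => ?_⟩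
  have hTη : ∑ k ∈ T, |y k| ^ p k < η := by
    have := hs T hT
    rwa [Real.norm_of_nonneg (Finset.sum_nonneg fun k _ => hnn k)] at this
  have hpt : ∀ k ∈ T, |c i k * y k| ≤ K * |y k| ^ p k +
      if 1 < p k then B * δ * |c i k * (B : ℝ)⁻¹| ^ conj (p k) else 0 := by
    intro k hk
    split_ifs with hpk
    · have hc := holderConjugate_conj hpk
      have hyoung := Real.young_inequality_of_nonneg (a := |y k| / δ)
        (b := δ * |c i k * (B : ℝ)⁻¹|) (by positivity) (by positivity) hc
      have e1 : |y k| / δ * (δ * |c i k * (B : ℝ)⁻¹|) = |c i k * y k| / B := by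
        rw [abs_mul, abs_mul, abs_inv, abs_of_pos hB0]
        field_simp
      have h1 : (|y k| / δ) ^ p k / p k ≤ δ ^ (-H) * |y k| ^ p k := by
        have hd : δ ^ (-(p k)) ≤ δ ^ (-H) :=
          Real.rpow_le_rpow_of_exponent_ge hδ0 hδ1 (by linarith [hH k])
        rw [Real.div_rpow (abs_nonneg _) hδ0.le, div_eq_mul_inv (|y k| ^ p k),
          ← Real.rpow_neg hδ0.le, mul_comm]
        calc δ ^ (-(p k)) * |y k| ^ p k / p k ≤ δ ^ (-(p k)) * |y k| ^ p k :=
              div_le_self (mul_nonneg (Real.rpow_nonneg hδ0.le _) (hnn k)) hpk.le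
          _ ≤ _ := mul_le_mul_of_nonneg_right hd (hnn k)
      have h2 : (δ * |c i k * (B : ℝ)⁻¹|) ^ conj (p k) / conj (p k)
          ≤ δ * |c i k * (B : ℝ)⁻¹| ^ conj (p k) := by
        have hd : δ ^ conj (p k) ≤ δ := by
          simpa using Real.rpow_le_rpow_of_exponent_ge hδ0 hδ1 hc.symm.lt.le
        rw [Real.mul_rpow hδ0.le (abs_nonneg _)]
        calc δ ^ conj (p k) * |c i k * (B : ℝ)⁻¹| ^ conj (p k) / conj (p k)
            ≤ δ ^ conj (p k) * |c i k * (B : ℝ)⁻¹| ^ conj (p k) :=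
              div_le_self (by positivity) hc.symm.lt.le
          _ ≤ _ := mul_le_mul_of_nonneg_right hd (by positivity)
      rw [e1] at hyoung
      have h3 : |c i k * y k| ≤
          B * (δ ^ (-H) * |y k| ^ p k + δ * |c i k * (B : ℝ)⁻¹| ^ conj (p k)) := by
        rw [mul_comm (B : ℝ), ← div_le_iff₀ hB0]
        linarith
      have h4 : 0 ≤ M * |y k| ^ p k := mul_nonneg hM0.le (hnn k)
      rw [hKdef]
      linarith
    · have h1 : |c i k| ^ p k ≤ M := (hM₁ i k (not_lt.1 hpk)).trans (le_max_left _ _)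
      have h2 : |c i k * y k| ^ p k ≤ M * |y k| ^ p k := by
        rw [abs_mul, Real.mul_rpow (abs_nonneg _) (abs_nonneg _)]
        exact mul_le_mul_of_nonneg_right h1 (hnn k)
      have h3 : |y k| ^ p k ≤ 1 / M :=
        ((Finset.single_le_sum (fun k _ => hnn k) hk).trans hTη.le).trans (min_le_left _ _)
      have h4 : |c i k * y k| ^ p k ≤ 1 := by
        refine h2.trans ?_
        rwa [le_div_iff₀ hM0, mul_comm] at h3
      have h5 : |c i k * y k| ≤ 1 := by
        by_contra hcon
        exact absurd h4 (not_le.2 (Real.one_lt_rpow (not_le.1 hcon) (hpos k)))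
      have h6 : |c i k * y k| ≤ |c i k * y k| ^ p k := by
        simpa using Real.rpow_le_rpow_of_exponent_ge' (abs_nonneg _) h5 (hpos k).le
          (not_lt.1 hpk)
      have h7 : 0 ≤ B * δ ^ (-H) * |y k| ^ p k := mul_nonneg (by positivity) (hnn k)
      rw [hKdef]
      linarith
  calc ∑ k ∈ T, |c i k * y k| ≤ ∑ k ∈ T, (K * |y k| ^ p k +
        if 1 < p k then B * δ * |c i k * (B : ℝ)⁻¹| ^ conj (p k) else 0) :=
        Finset.sum_le_sum hpt
    _ = K * ∑ k ∈ T, |y k| ^ p k +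
        B * δ * ∑ k ∈ T with 1 < p k, |c i k * (B : ℝ)⁻¹| ^ conj (p k) := by
        rw [Finset.sum_add_distrib, ← Finset.sum_filter, Finset.mul_sum, Finset.mul_sum]
    _ ≤ K * (ε / (2 * K)) + B * δ * N := by
        refine add_le_add (mul_le_mul_of_nonneg_left (hTη.le.trans (min_le_right _ _)) hK0.le)
          (mul_le_mul_of_nonneg_left ?_ (by positivity))
        exact (hM₂ i _ fun k hk => (Finset.mem_filter.1 hk).2).trans (le_max_left _ _)
    _ ≤ ε / 2 + ε / 2 := by
        refine add_le_add (le_of_eq ?_) hδN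
        field_simp
    _ = ε := by ring

/-- For `p k > 1` the second bound also controls the powers `|c i k| ^ p k`. -/
theorem bounded_rpow_of_bounds (hpos : ∀ k, 0 < p k) (hbdd : BddAbove (Set.range p))
    (hA : ∃ M, ∀ i k, p k ≤ 1 → |c i k| ^ p k ≤ M)
    (hB : ∃ B : ℕ, 1 < B ∧ ∃ M, ∀ i, ∀ T : Finset ℕ, (∀ k ∈ T, 1 < p k) →
      ∑ k ∈ T, |c i k * (B : ℝ)⁻¹| ^ conj (p k) ≤ M) :
    ∃ M, ∀ i k, |c i k| ^ p k ≤ M := by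
  obtain ⟨H, hH⟩ := hbdd
  replace hH : ∀ k, p k ≤ H := fun k => hH ⟨k, rfl⟩
  obtain ⟨M₁, hM₁⟩ := hA
  obtain ⟨B, hB1, M₂, hM₂⟩ := hB
  have hB0 : (1 : ℝ) < B := by exact_mod_cast hB1
  set N := max M₂ 1 with hNdef
  have hN1 : 1 ≤ N := le_max_right _ _
  refine ⟨max M₁ ((B * N) ^ H), fun i k => ?_⟩
  rcases le_or_gt (p k) 1 with hpk | hpk
  · exact (hM₁ i k hpk).trans (le_max_left _ _)
  · refine le_trans ?_ (le_max_right _ _)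
    have hc := holderConjugate_conj hpk
    have h1 : |c i k * (B : ℝ)⁻¹| ^ conj (p k) ≤ N := by
      have := hM₂ i {k} (by simpa using hpk)
      rw [Finset.sum_singleton] at this
      exact this.trans (le_max_left _ _)
    have h2 : |c i k * (B : ℝ)⁻¹| ≤ N := by
      by_contra hcon
      push Not at hcon
      have := Real.rpow_le_rpow_of_exponent_le (hN1.trans hcon.le) hc.symm.lt.le
      rw [Real.rpow_one] at this
      linarith
    have h3 : |c i k| ≤ B * N := by
      rw [abs_mul, abs_inv, abs_of_pos (by linarith : (0 : ℝ) < B), ← div_eq_mul_inv,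
        div_le_iff₀ (by linarith)] at h2
      linarith
    calc |c i k| ^ p k ≤ (B * N) ^ p k := Real.rpow_le_rpow (abs_nonneg _) h3 (hpos k).le
      _ ≤ (B * N) ^ H := Real.rpow_le_rpow_of_exponent_le (by nlinarith) (hH k)

/-- Sufficiency of the two bounds. -/
theorem pointwise_bounded_of_bounds (hpos : ∀ k, 0 < p k) (hbdd : BddAbove (Set.range p))
    (hA : ∃ M, ∀ i k, p k ≤ 1 → |c i k| ^ p k ≤ M)
    (hB : ∃ B : ℕ, 1 < B ∧ ∃ M, ∀ i, ∀ T : Finset ℕ, (∀ k ∈ T, 1 < p k) →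
      ∑ k ∈ T, |c i k * (B : ℝ)⁻¹| ^ conj (p k) ≤ M)
    {y : ℕ → ℝ} (hy : y ∈ ell p) :
    ∃ M, ∀ i, |∑ k ∈ S i, c i k * y k| ≤ M := by
  classical
  obtain ⟨s, hs⟩ := exists_uniform_tail hpos hbdd hA hB hy one_pos
  obtain ⟨M, hM⟩ := bounded_rpow_of_bounds hpos hbdd hA hB
  refine ⟨∑ k ∈ s, M ^ (p k)⁻¹ * |y k| + 1, fun i => ?_⟩
  have hM0 : 0 ≤ M := (Real.rpow_nonneg (abs_nonneg _) _).trans (hM i 0)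
  refine (Finset.abs_sum_le_sum_abs _ _).trans ?_
  rw [← Finset.sum_filter_add_sum_filter_not (S i) (· ∈ s)]
  refine add_le_add ?_ (hs _ ?_ i)
  · calc ∑ k ∈ S i with k ∈ s, |c i k * y k| ≤ ∑ k ∈ S i with k ∈ s, M ^ (p k)⁻¹ * |y k| := by
          refine Finset.sum_le_sum fun k _ => ?_
          rw [abs_mul]
          refine mul_le_mul_of_nonneg_right ?_ (abs_nonneg _)
          exact (Real.le_rpow_inv_iff_of_pos (abs_nonneg _) hM0 (hpos k)).2 (hM i k)
      _ ≤ _ := Finset.sum_le_sum_of_subset_of_nonneg (fun k hk => (Finset.mem_filter.1 hk).2)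
          fun k _ _ => by positivity
  · rw [Finset.disjoint_left]
    intro k hk
    exact (Finset.mem_filter.1 hk).2

/-- Under the two bounds, coefficientwise convergence gives pointwise convergence. -/
theorem cauchySeq_of_bounds {c : ℕ → ℕ → ℝ} {S : ℕ → Finset ℕ} (hpos : ∀ k, 0 < p k)
    (hbdd : BddAbove (Set.range p)) (hS : ∀ i k, k ∉ S i → c i k = 0)
    (hA : ∃ M, ∀ i k, p k ≤ 1 → |c i k| ^ p k ≤ M)
    (hB : ∃ B : ℕ, 1 < B ∧ ∃ M, ∀ i, ∀ T : Finset ℕ, (∀ k ∈ T, 1 < p k) →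
      ∑ k ∈ T, |c i k * (B : ℝ)⁻¹| ^ conj (p k) ≤ M)
    (hlim : ∀ k, ∃ l, Tendsto (fun n => c n k) atTop (𝓝 l))
    {y : ℕ → ℝ} (hy : y ∈ ell p) :
    CauchySeq fun n => ∑ k ∈ S n, c n k * y k := by
  classical
  rw [Metric.cauchySeq_iff]
  intro ε hε
  obtain ⟨s, hs⟩ := exists_uniform_tail hpos hbdd hA hB hy (show 0 < ε / 3 by positivity)
  choose l hl using hlim
  have hmain : Tendsto (fun n => ∑ k ∈ s, c n k * y k) atTop (𝓝 (∑ k ∈ s, l k * y k)) :=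
    tendsto_finsetSum _ fun k _ => (hl k).mul_const _
  obtain ⟨N, hN⟩ := Metric.cauchySeq_iff.1 hmain.cauchySeq (ε / 3) (by positivity)
  have htail : ∀ n, |∑ k ∈ S n, c n k * y k - ∑ k ∈ s, c n k * y k| ≤ ε / 3 := by
    intro n
    have e : ∑ k ∈ S n, c n k * y k - ∑ k ∈ s, c n k * y k = ∑ k ∈ S n \ s, c n k * y k := by
      have h1 : ∑ k ∈ s, c n k * y k = ∑ k ∈ S n ∪ s with k ∈ s, c n k * y k := by
        congr 1
        ext k
        simp only [Finset.mem_filter, Finset.mem_union]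
        tauto
      have h2 : ∑ k ∈ S n, c n k * y k = ∑ k ∈ S n ∪ s, c n k * y k :=
        Finset.sum_subset Finset.subset_union_left fun k _ hk => by rw [hS n k hk, zero_mul]
      have h3 : S n \ s = (S n ∪ s).filter (· ∉ s) := by
        ext k
        simp only [Finset.mem_filter, Finset.mem_union, Finset.mem_sdiff]
        tauto
      rw [h1, h2, h3, ← Finset.sum_filter_add_sum_filter_not (S n ∪ s) (· ∈ s)]
      ring
    rw [e]
    exact (Finset.abs_sum_le_sum_abs _ _).trans (hs _ Finset.sdiff_disjoint n)
  refine ⟨N, fun m hm n hn => ?_⟩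
  have h1 := hN m hm n hn
  have h2 := htail m
  have h3 := htail n
  rw [Real.dist_eq] at h1 ⊢
  rw [abs_lt] at h1 ⊢
  rw [abs_le] at h2 h3
  constructor <;> linarith

end Functionals

/-! ### Inversion of the Fibonacci transform. -/

theorem f_pos (n : ℕ) : 0 < f n := by
  unfold f
  exact_mod_cast Nat.fib_pos.2 n.succ_pos

/-- The inverse of the `F̂`-transform. -/
noncomputable def fibInverse (y : ℕ → ℝ) (n : ℕ) : ℝ :=
  f (n + 1) ^ 2 * ∑ k ∈ Finset.range (n + 1), y k / (f k * f (k + 1))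

theorem fibTransform_fibInverse (y : ℕ → ℝ) : fibTransform (fibInverse y) = y := by
  funext n
  cases n with
  | zero =>
    have h0 := (f_pos 0).ne'
    have h1 := (f_pos 1).ne'
    rw [fibTransform_zero]
    simp only [fibInverse, zero_add, Finset.sum_range_one]
    field_simp
  | succ n =>
    have h1 := (f_pos (n + 1)).ne'
    have h2 := (f_pos (n + 2)).ne'
    rw [fibTransform_succ]
    simp only [fibInverse, Finset.sum_range_succ _ (n + 1), show n + 1 + 1 = n + 2 from rfl]
    field_simp
    ring

theorem fibTransform_injective : Function.Injective fibTransform := by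
  intro x x' h
  funext n
  induction n with
  | zero =>
    have h0 := congrFun h 0
    rw [fibTransform_zero, fibTransform_zero] at h0
    exact mul_left_cancel₀ (div_ne_zero (f_pos 0).ne' (f_pos 1).ne') h0
  | succ n ih =>
    have h0 := congrFun h (n + 1)
    rw [fibTransform_succ, fibTransform_succ, ih] at h0
    exact mul_left_cancel₀ (div_ne_zero (f_pos (n + 1)).ne' (f_pos (n + 2)).ne')
      (sub_left_injective h0)

theorem forall_mem_ellF_iff {p : ℕ → ℝ} {P : (ℕ → ℝ) → Prop} :
    (∀ x ∈ ellF p, P x) ↔ ∀ y ∈ ell p, P (fibInverse y) := by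
  constructor
  · intro h y hy
    refine h _ ?_
    change fibTransform _ ∈ ell p
    rwa [fibTransform_fibInverse]
  · intro h x hx
    have := h _ hx
    rwa [fibTransform_injective (fibTransform_fibInverse (fibTransform x))] at this

/-! ### Duals and bounding sets in terms of the coefficients. -/

/-- The coefficient of `y k` in `∑ n ∈ K, fibInverse y n * a n`. -/
noncomputable def coef (a : ℕ → ℝ) (K : Finset ℕ) (k : ℕ) : ℝ :=
  ∑ n ∈ K with k ≤ n, f (n + 1) ^ 2 / (f k * f (k + 1)) * a n

/-- The columns on which `coef a K` may be nonzero. -/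
def columns (K : Finset ℕ) : Finset ℕ := Finset.range (K.sup id + 1)

theorem le_sup_of_mem {K : Finset ℕ} {n : ℕ} (hn : n ∈ K) : n ≤ K.sup id :=
  Finset.le_sup (f := id) hn

theorem coef_eq_zero (a : ℕ → ℝ) (K : Finset ℕ) (k : ℕ) (hk : k ∉ columns K) :
    coef a K k = 0 := by
  refine Finset.sum_eq_zero fun n hn => ?_
  rw [Finset.mem_filter] at hn
  have := le_sup_of_mem hn.1
  rw [columns, Finset.mem_range] at hk
  omega

theorem sum_fibInverse_mul (a y : ℕ → ℝ) (K : Finset ℕ) :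
    ∑ n ∈ K, fibInverse y n * a n = ∑ k ∈ columns K, coef a K k * y k := by
  simp only [coef, Finset.sum_mul, Finset.sum_filter]
  simp only [ite_mul, zero_mul]
  rw [Finset.sum_comm]
  refine Finset.sum_congr rfl fun n hn => ?_
  rw [← Finset.sum_filter, fibInverse, Finset.mul_sum, Finset.sum_mul]
  have e : {k ∈ columns K | k ≤ n} = Finset.range (n + 1) := by
    ext k
    have := le_sup_of_mem hn
    simp only [columns, Finset.mem_filter, Finset.mem_range]
    omega
  rw [e]
  refine Finset.sum_congr rfl fun k _ => ?_
  ring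

theorem sum_Icc_eq_coef (a : ℕ → ℝ) (n k : ℕ) :
    ∑ j ∈ Finset.Icc k n, f (j + 1) ^ 2 / (f k * f (k + 1)) * a j
      = coef a (Finset.range (n + 1)) k := by
  rw [coef]
  congr 1
  ext j
  simp only [Finset.mem_Icc, Finset.mem_filter, Finset.mem_range]
  omega

theorem columns_range (n : ℕ) : columns (Finset.range (n + 1)) = Finset.range (n + 1) := by
  rw [columns]
  congr 2
  refine le_antisymm (Finset.sup_le fun k hk => ?_)
    (le_sup_of_mem (Finset.self_mem_range_succ n))
  exact Nat.lt_succ_iff.1 (Finset.mem_range.1 hk)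

theorem bddAbove_range_iff {α : Type*} (g : α → ℝ) :
    BddAbove (Set.range g) ↔ ∃ M, ∀ i, g i ≤ M := by
  simp [BddAbove, upperBounds, Set.Nonempty]

/-- Splitting `K` by the sign of `z` bounds the absolute sum by `2 * M`. This makes absolute
convergence a uniform bound over finite sets. -/
theorem summable_abs_iff_sum_bounded (z : ℕ → ℝ) :
    (Summable fun k => |z k|) ↔ ∃ M, ∀ K : Finset ℕ, |∑ k ∈ K, z k| ≤ M := by
  classical
  constructor
  · intro h
    exact ⟨∑' k, |z k|, fun K => (Finset.abs_sum_le_sum_abs _ _).trans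
      (h.sum_le_tsum K fun k _ => abs_nonneg _)⟩
  · rintro ⟨M, hM⟩
    refine summable_of_sum_le (c := 2 * M) (fun k => abs_nonneg _) fun K => ?_
    have h1 : ∑ k ∈ K with 0 ≤ z k, |z k| = ∑ k ∈ K with 0 ≤ z k, z k :=
      Finset.sum_congr rfl fun k hk => abs_of_nonneg (Finset.mem_filter.1 hk).2
    have h2 : ∑ k ∈ K with ¬0 ≤ z k, |z k| = -∑ k ∈ K with ¬0 ≤ z k, z k := by
      rw [← Finset.sum_neg_distrib]
      exact Finset.sum_congr rfl fun k hk =>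
        abs_of_nonpos (not_le.1 (Finset.mem_filter.1 hk).2).le
    rw [← Finset.sum_filter_add_sum_filter_not K (0 ≤ z ·), h1, h2]
    have h3 := (abs_le.1 (hM {k ∈ K | 0 ≤ z k})).2
    have h4 := (abs_le.1 (hM {k ∈ K | ¬0 ≤ z k})).1
    linarith

theorem mem_alphaDual_iff {p a : ℕ → ℝ} : a ∈ alphaDual (ellF p) ↔
    ∀ y ∈ ell p, ∃ M, ∀ K : Finset ℕ, |∑ k ∈ columns K, coef a K k * y k| ≤ M := by
  refine forall_mem_ellF_iff.trans (forall₂_congr fun y _ => ?_)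
  refine (summable_abs_iff_sum_bounded fun k => fibInverse y k * a k).trans ?_
  simp only [sum_fibInverse_mul]

theorem mem_gammaDual_iff {p a : ℕ → ℝ} : a ∈ gammaDual (ellF p) ↔
    ∀ y ∈ ell p, ∃ M, ∀ n : ℕ, |∑ k ∈ columns (Finset.range (n + 1)),
      coef a (Finset.range (n + 1)) k * y k| ≤ M := by
  refine forall_mem_ellF_iff.trans (forall₂_congr fun y _ => ?_)
  refine (bddAbove_range_iff _).trans ?_
  simp only [sum_fibInverse_mul]

theorem mem_betaDual_iff {p a : ℕ → ℝ} : a ∈ betaDual (ellF p) ↔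
    ∀ y ∈ ell p, ∃ l, Tendsto (fun n : ℕ => ∑ k ∈ columns (Finset.range (n + 1)),
      coef a (Finset.range (n + 1)) k * y k) atTop (𝓝 l) := by
  refine forall_mem_ellF_iff.trans (forall₂_congr fun y _ => ?_)
  simp only [cs, Set.mem_ofPred_eq, sum_fibInverse_mul]

theorem mem_F12_iff {p a : ℕ → ℝ} :
    a ∈ F12 p ↔ ∃ M, ∀ K k, |coef a K k| ^ p k ≤ M := by
  refine (bddAbove_range_iff _).trans ?_
  simp only [Prod.forall]
  rfl

theorem mem_F15_iff {p a : ℕ → ℝ} :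
    a ∈ F15 p ↔ ∃ M, ∀ n k, |coef a (Finset.range (n + 1)) k| ^ p k ≤ M := by
  refine (bddAbove_range_iff _).trans ?_
  simp only [Prod.forall, sum_Icc_eq_coef]

theorem mem_F16_iff {a : ℕ → ℝ} : a ∈ F16 ↔
    ∀ k, ∃ l, Tendsto (fun n => coef a (Finset.range (n + 1)) k) atTop (𝓝 l) := by
  simp only [F16, Set.mem_ofPred_eq, sum_Icc_eq_coef]

theorem mem_F13_iff {p a : ℕ → ℝ} (hp : ∀ k, 1 < p k) : a ∈ F13 p ↔
    ∃ B : ℕ, 1 < B ∧ ∃ M, ∀ K, ∀ T : Finset ℕ, (∀ k ∈ T, 1 < p k) →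
      ∑ k ∈ T, |coef a K k * (B : ℝ)⁻¹| ^ conj (p k) ≤ M := by
  simp only [F13, Set.mem_ofPred_eq, ← Finset.sum_mul]
  refine exists_congr fun B => and_congr_right fun _ => ?_
  change (⨆ K : Finset ℕ, ∑' k : ℕ, ENNReal.ofReal (|coef a K k * (B : ℝ)⁻¹| ^ conj (p k))) < ⊤ ↔ _
  constructor
  · intro h
    refine ⟨_, fun K T _ => (ENNReal.ofReal_le_iff_le_toReal h.ne).1 ?_⟩
    rw [ENNReal.ofReal_sum_of_nonneg fun k _ => by positivity]
    exact (ENNReal.sum_le_tsum T).trans (le_iSup (fun K : Finset ℕ =>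
      ∑' k : ℕ, ENNReal.ofReal (|coef a K k * (B : ℝ)⁻¹| ^ conj (p k))) K)
  · rintro ⟨M, hM⟩
    refine lt_of_le_of_lt (iSup_le fun K => ?_) (ENNReal.ofReal_lt_top (r := M))
    rw [ENNReal.tsum_eq_iSup_sum]
    refine iSup_le fun T => ?_
    rw [← ENNReal.ofReal_sum_of_nonneg fun k _ => by positivity]
    exact ENNReal.ofReal_le_ofReal (hM K T fun k _ => hp k)

theorem mem_F14_iff {p a : ℕ → ℝ} : a ∈ F14 p ↔
    ∃ B : ℕ, 1 < B ∧ ∃ M, ∀ n : ℕ, ∀ T : Finset ℕ, (∀ k ∈ T, 1 < p k) →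
      ∑ k ∈ T, |coef a (Finset.range (n + 1)) k * (B : ℝ)⁻¹| ^ conj (p k) ≤ M := by
  classical
  simp only [F14, Set.mem_ofPred_eq, ← Finset.sum_mul, sum_Icc_eq_coef, bddAbove_range_iff]
  refine exists_congr fun B => and_congr_right fun _ => exists_congr fun M =>
    forall_congr' fun n => ?_
  constructor
  · intro h T hT
    refine le_trans ?_ h
    rw [← Finset.sum_subset (Finset.inter_subset_left (s₁ := T) (s₂ := Finset.range (n + 1)))]
    · refine Finset.sum_le_sum_of_subset_of_nonneg (fun k hk => ?_) fun k _ _ => by positivity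
      rw [Finset.mem_inter] at hk
      exact Finset.mem_filter.2 ⟨hk.2, hT k hk.1⟩
    · intro k hk hk'
      -- Indices beyond `n` contribute `0 ^ p k'`, which is `0` because the conjugate exponent is
      -- nonzero.
      rw [coef_eq_zero, zero_mul, abs_zero,
        Real.zero_rpow (holderConjugate_conj (hT k hk)).symm.ne_zero]
      rw [columns_range]
      exact fun h => hk' (Finset.mem_inter.2 ⟨hk, h⟩)
  · exact fun h => h _ fun k hk => (Finset.mem_filter.1 hk).2

/-! ### Assembling the three duals. -/

theorem exists_bound_of_forall_le_one {ι : Type*} {p : ℕ → ℝ} (hp : ∀ k, p k ≤ 1)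
    (c : ι → ℕ → ℝ) : ∃ B : ℕ, 1 < B ∧ ∃ M, ∀ i, ∀ T : Finset ℕ, (∀ k ∈ T, 1 < p k) →
      ∑ k ∈ T, |c i k * (B : ℝ)⁻¹| ^ conj (p k) ≤ M := by
  refine ⟨2, one_lt_two, 0, fun i T hT => (Finset.sum_eq_zero fun k hk => ?_).le⟩
  exact absurd (hT k hk) (not_lt.2 (hp k))

theorem exists_bound_of_forall_one_lt {ι : Type*} {p : ℕ → ℝ} (hp : ∀ k, 1 < p k)
    (c : ι → ℕ → ℝ) : ∃ M, ∀ i k, p k ≤ 1 → |c i k| ^ p k ≤ M :=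
  ⟨0, fun _ k hk => absurd (hp k) (not_lt.2 hk)⟩

theorem pointwise_bounded_iff {ι : Type*} {p : ℕ → ℝ} (c : ι → ℕ → ℝ) (S : ι → Finset ℕ)
    (hpos : ∀ k, 0 < p k) (hbdd : BddAbove (Set.range p)) (hS : ∀ i k, k ∉ S i → c i k = 0) :
    (∀ y ∈ ell p, ∃ M, ∀ i, |∑ k ∈ S i, c i k * y k| ≤ M) ↔
    (∃ M, ∀ i k, p k ≤ 1 → |c i k| ^ p k ≤ M) ∧
    ∃ B : ℕ, 1 < B ∧ ∃ M, ∀ i, ∀ T : Finset ℕ, (∀ k ∈ T, 1 < p k) →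
      ∑ k ∈ T, |c i k * (B : ℝ)⁻¹| ^ conj (p k) ≤ M :=
  ⟨bounds_of_pointwise_bounded hpos hS,
    fun h _ hy => pointwise_bounded_of_bounds hpos hbdd h.1 h.2 hy⟩

theorem mem_F16_of_mem_betaDual {p a : ℕ → ℝ} (hpos : ∀ k, 0 < p k)
    (ha : a ∈ betaDual (ellF p)) : a ∈ F16 := by
  rw [mem_betaDual_iff] at ha
  refine mem_F16_iff.2 fun k => ?_
  obtain ⟨l, hl⟩ := ha _ (single_mem_ell hpos k)
  refine ⟨l, hl.congr fun n => ?_⟩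
  by_cases hk : k ∈ columns (Finset.range (n + 1))
  · simp [Pi.single_apply, hk]
  · simp [Pi.single_apply, hk, coef_eq_zero a _ k hk]

theorem betaDual_subset_gammaDual (X : Set (ℕ → ℝ)) : betaDual X ⊆ gammaDual X := by
  intro a ha x hx
  obtain ⟨l, hl⟩ := ha x hx
  exact hl.abs.bddAbove_range

end FibSeq

theorem theorem2p11 (p : ℕ → ℝ) (hpos : ∀ k, 0 < p k) (hbdd : BddAbove (Set.range p)) :
    ((∀ k, p k ≤ 1) → FibSeq.alphaDual (FibSeq.ellF p) = FibSeq.F12 p) ∧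
    ((∀ k, 1 < p k) → FibSeq.alphaDual (FibSeq.ellF p) = FibSeq.F13 p) ∧
    ((∀ k, p k ≤ 1) → FibSeq.gammaDual (FibSeq.ellF p) = FibSeq.F15 p) ∧
    ((∀ k, 1 < p k) → FibSeq.gammaDual (FibSeq.ellF p) = FibSeq.F14 p) ∧
    FibSeq.betaDual (FibSeq.ellF p) = FibSeq.F14 p ∩ FibSeq.F15 p ∩ FibSeq.F16 := by
  open FibSeq in
  have hα : ∀ a, _ ↔ _ := fun a => (mem_alphaDual_iff (a := a)).trans
    (pointwise_bounded_iff (coef a) columns hpos hbdd (coef_eq_zero a))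
  have hS : ∀ (a : ℕ → ℝ) (n k : ℕ), k ∉ FibSeq.columns (Finset.range (n + 1)) →
      FibSeq.coef a (Finset.range (n + 1)) k = 0 := fun a n => FibSeq.coef_eq_zero a _
  open FibSeq in
  have hγ : ∀ a, _ ↔ _ := fun a => (mem_gammaDual_iff (a := a)).trans
    (pointwise_bounded_iff _ _ hpos hbdd (hS a))
  refine ⟨fun hp => ?_, fun hp => ?_, fun hp => ?_, fun hp => ?_, ?_⟩
  · ext a
    rw [hα, FibSeq.mem_F12_iff, and_iff_left (FibSeq.exists_bound_of_forall_le_one hp _)]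
    simp only [hp, true_imp_iff]
  · ext a
    rw [hα, FibSeq.mem_F13_iff hp, and_iff_right (FibSeq.exists_bound_of_forall_one_lt hp _)]
  · ext a
    rw [hγ, FibSeq.mem_F15_iff, and_iff_left (FibSeq.exists_bound_of_forall_le_one hp _)]
    simp only [hp, true_imp_iff]
  · ext a
    rw [hγ, FibSeq.mem_F14_iff, and_iff_right (FibSeq.exists_bound_of_forall_one_lt hp _)]
  · ext a
    constructor
    · intro ha
      -- `F15` constrains every `k`; where `p k > 1` its bound follows from the conjugate-exponent
      -- bound and the boundedness of `p`.
      obtain ⟨hA, hB⟩ := (hγ a).1 (FibSeq.betaDual_subset_gammaDual _ ha)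
      exact ⟨⟨FibSeq.mem_F14_iff.2 hB,
        FibSeq.mem_F15_iff.2 (FibSeq.bounded_rpow_of_bounds hpos hbdd hA hB)⟩,
        FibSeq.mem_F16_of_mem_betaDual hpos ha⟩
    · rintro ⟨⟨h14, h15⟩, h16⟩
      rw [FibSeq.mem_F14_iff] at h14
      rw [FibSeq.mem_F15_iff] at h15
      obtain ⟨M, hM⟩ := h15
      exact FibSeq.mem_betaDual_iff.2 fun y hy => cauchySeq_tendsto_of_complete
        (FibSeq.cauchySeq_of_bounds hpos hbdd (hS a) ⟨M, fun n k _ => hM n k⟩ h14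
          (FibSeq.mem_F16_iff.1 h16) hy)
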